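/- **Cellular automaton transducers.** A cellular automaton transducer (CAT) has a finite set $S$ of cell states, accepting states $F\subseteq S$, a finite nonempty input alphabet $A\subseteq S$, a finite output alphabet $B$, a boundary symbol $\#\notin S$ and a local function $\delta:(S\cup\{\#\})\times S\times(S\cup\{\#\})\to S\times(B^*\cup\{\bot\})$. On an input $w=a_1\cdots a_n\in A^+$ it works synchronously on cells $1,\dots,n$; cell $i$ starts in state $a_i$ with output register $\bot$ (empty). In each step every cell applies $\delta$ to the states of its left neighbour, itself and its right neighbour ($\#$ beyond the ends); the first component is its new state, and the second is put into its register if the register still holds $\bot$. The CAT realizes the set of pairs $(w,v)\in A^+\times B^*$ such that the leftmost cell is at some time in a state of $F$, and at some time all registers are filled, with concatenation $v$ from left to right. It is of time complexity $(t_i,t_o)$ if for every such pair the acceptance happens after at most $t_i(|w|)$ steps and all registers are filled after at most $t_o(|w|)$ steps. **Iterative array transducers.** An iterative array transducer (IAT) has a finite state set $S$, accepting states $F\subseteq S$, a finite nonempty input alphabet $A$, a finite output alphabet $B$, an end-of-input symbol $\triangleleft\notin A$, a quiescent state $s_0\in S$, a function $\delta:S^3\to S$ with $\delta(s_0,s_0,s_0)=s_0$,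 and a partial function $\delta_0:(A\cup\{\triangleleft\})\times S^2\to B^*\times S$. It works synchronously on cells $0,1,2,\dots$, all starting in $s_0$. In step $t$ the communication cell $0$ reads the $t$-th input symbol ($\triangleleft$ after the end of the input) and, by $\delta_0$ applied to this symbol, its own state and the state of cell $1$, emits a word of $B^*$ and changes its state; every other cell applies $\delta$ to the states of its left neighbour, itself and its right neighbour. The array halts when $\delta_0$ is undefined. The IAT computes the set of pairs $(w,v)\in A^+\times B^*$ such that on input $w$ cell $0$ is at some time in a state of $F$, the array halts, and $v$ is the total output emitted. It is of time complexity $(t_i,t_o)$ if for every such pair the acceptance happens after at most $t_i(|w|)$ steps, all of $v$ has been emitted after at most $t_o(|w|)$ steps, and the array halts after at most $\max\{t_i(|w|),t_o(|w|)\}$ steps. **Families.** $\mathscr{T}(\mathrm{CAT}_{t_i,t_o})$ and $\mathscr{T}(\mathrm{IAT}_{t_i,t_o})$ are the families of transductions realized, respectively computed, by such devices of time complexity $(t_i,t_o)$. An index $rt$ (real time) stands for the function $n$ in the case of CATs and $n+1$ in the case of IATs; an index $lt$ (linear time) stands for some function $\lfloor k\cdot n\rfloor$ with a rational constant $k\ge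 1$. **Proposition.** The family $\mathscr{T}(\mathrm{IAT}_{lt,rt})$ is strictly included in $\mathscr{T}(\mathrm{CAT}_{lt,rt})$. Moreover, the reversal transduction $\{(w,w^R)\mid w\in\{a,b\}^+\}$ over a two-letter alphabet belongs to $\mathscr{T}(\mathrm{CAT}_{rt,rt})$, but it belongs neither to $\mathscr{T}(\mathrm{IAT}_{rt,rt})$ nor to $\mathscr{T}(\mathrm{IAT}_{lt,rt})$. -/

import Mathlib

/-- A transduction: a set of pairs (input word, output word) over a finite nonempty input
alphabet and a finite output alphabet. -/
structure Transduction where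
  /-- The input alphabet. -/
  inAlph : Type
  /-- The output alphabet. -/
  outAlph : Type
  finite_in : Finite inAlph
  nonempty_in : Nonempty inAlph
  finite_out : Finite outAlph
  /-- The pairs of words. -/
  pairs : Set (List inAlph × List outAlph)

/-! ### Cellular automaton transducers -/

/-- A (two-way, one-dimensional) cellular automaton transducer with input alphabet `A` and output
alphabet `B`. The boundary symbol is the element `none` of `Option State`, and the symbol `⊥`
(no output so far) is the element `none` of `Option (List B)`. -/
structure CAT (A B : Type) where
  /-- The cell states. -/
  State : Type
  finite_state : Finite State
  /-- The accepting states. -/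
  accepting : Set State
  /-- The inclusion of the input symbols in the states. -/
  input : A ↪ State
  /-- The local transition function: states of the left neighbour, of the cell itself and of the
  right neighbour give the next state and the emitted output, if any. -/
  delta : Option State → State → Option State → State × Option (List B)

namespace CAT

variable {A B : Type}

/-- A configuration of `n` cells: their states and the contents of their output registers. -/
structure Config (M : CAT A B) (n : ℕ) where
  state : Fin n → M.State
  out : Fin n → Option (List B)

/-- What a cell sees on its left: the state of the left neighbour or the boundary symbol. -/
def leftOf (M : CAT A B) {n : ℕ} (c : Fin n → M.State) (i : Fin n) : Option M.State :=
  if h : 0 < i.val then some (c ⟨i.val - 1, by omega⟩) else none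

/-- What a cell sees on its right: the state of the right neighbour or the boundary symbol. -/
def rightOf (M : CAT A B) {n : ℕ} (c : Fin n → M.State) (i : Fin n) : Option M.State :=
  if h : i.val + 1 < n then some (c ⟨i.val + 1, h⟩) else none

/-- The value of the local transition function at the cell `i`. -/
def localStep (M : CAT A B) {n : ℕ} (c : Fin n → M.State) (i : Fin n) :
    M.State × Option (List B) :=
  M.delta (M.leftOf c i) (c i) (M.rightOf c i)

/-- The global transition function. An output register that has been filled is never changed. -/
def step (M : CAT A B) {n : ℕ} (C : M.Config n) : M.Config n where
  state := fun i => (M.localStep C.state i).1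
  out := fun i =>
    match C.out i with
    | some u => some u
    | none => (M.localStep C.state i).2

/-- The initial configuration for the input `w`. -/
def init (M : CAT A B) (w : List A) : M.Config w.length where
  state := fun i => M.input (w.get i)
  out := fun _ => none

/-- The configuration reached after `t` steps on the input `w`. -/
def run (M : CAT A B) (w : List A) : ℕ → M.Config w.length
  | 0 => M.init w
  | t + 1 => M.step (M.run w t)

/-- At time `t`, the leftmost cell is in an accepting state. -/
def AcceptsAt (M : CAT A B) (w : List A) (t : ℕ) : Prop :=
  ∃ h : 0 < w.length, (M.run w t).state ⟨0, h⟩ ∈ M.accepting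

/-- At time `t`, all output registers are filled and their contents, from left to right, form
the word `v`. -/
def OutputsAt (M : CAT A B) (w : List A) (v : List B) (t : ℕ) : Prop :=
  ∃ u : Fin w.length → List B,
    (∀ i, (M.run w t).out i = some (u i)) ∧ v = (List.ofFn u).flatten

/-- The transduction realized by `M`: nonempty input words that are accepted and transformed. -/
def transduction (M : CAT A B) : Set (List A × List B) :=
  {p | p.1 ≠ [] ∧ (∃ t, M.AcceptsAt p.1 t) ∧ ∃ t, M.OutputsAt p.1 p.2 t}

/-- `M` is of time complexity `(tI, tO)`. -/
def HasTime (M : CAT A B) (tI tO : ℕ → ℕ) : Prop :=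
  ∀ p ∈ M.transduction,
    (∃ t ≤ tI p.1.length, M.AcceptsAt p.1 t) ∧
    (∃ t ≤ tO p.1.length, ∀ i, (M.run p.1 t).out i ≠ none)

end CAT

/-! ### Iterative array transducers -/

/-- An iterative array transducer with input alphabet `A` and output alphabet `B`. The
end-of-input symbol is the element `none` of `Option A`. -/
structure IAT (A B : Type) where
  /-- The cell states. -/
  State : Type
  finite_state : Finite State
  /-- The accepting states. -/
  accepting : Set State
  /-- The quiescent state. -/
  quiescent : State
  /-- The local transition function of the non-communication cells: states of the left neighbour,
  of the cell itself and of the right neighbour. -/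
  delta : State → State → State → State
  delta_quiescent : delta quiescent quiescent quiescent = quiescent
  /-- The partial local transition function of the communication cell: current input symbol, state
  of the cell itself and state of its right neighbour. -/
  delta0 : Option A → State → State → Option (List B × State)

namespace IAT

variable {A B : Type}

/-- A configuration: the states of the cells, the communication cell being cell `0`, and the
total output emitted so far. -/
structure Config (M : IAT A B) where
  state : ℕ → M.State
  out : List B

/-- One step of the whole array when the communication cell reads `x`; it is undefined if `delta0`
is undefined. -/
def step (M : IAT A B) (x : Option A) (C : M.Config) : Option M.Config :=
  (M.delta0 x (C.state 0) (C.state 1)).map fun r =>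
    { state := fun i =>
        match i with
        | 0 => r.2
        | j + 1 => M.delta (C.state j) (C.state (j + 1)) (C.state (j + 2))
      out := C.out ++ r.1 }

/-- The configuration reached after `t` steps on the input `w`, and `none` if the array has halted
before. Step `t + 1` reads `w[t]?`, which is the end-of-input symbol once `w` is consumed. -/
def run (M : IAT A B) (w : List A) : ℕ → Option M.Config
  | 0 => some { state := fun _ => M.quiescent, out := [] }
  | t + 1 => (M.run w t).bind (M.step w[t]?)

/-- At time `t`, the communication cell is in an accepting state. -/
def AcceptsAt (M : IAT A B) (w : List A) (t : ℕ) : Prop :=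
  ∃ C, M.run w t = some C ∧ C.state 0 ∈ M.accepting

/-- At time `t`, the total output emitted so far is `v`. -/
def EmittedAt (M : IAT A B) (w : List A) (v : List B) (t : ℕ) : Prop :=
  ∃ C, M.run w t = some C ∧ C.out = v

/-- The array halts after exactly `t` steps. -/
def HaltsAt (M : IAT A B) (w : List A) (t : ℕ) : Prop :=
  (∃ C, M.run w t = some C) ∧ M.run w (t + 1) = none

/-- The transduction computed by `M`: the input is accepted, the array halts, and the second
component is the total output. As for cellular automata, inputs are nonempty words. -/
def transduction (M : IAT A B) : Set (List A × List B) :=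
  {p | p.1 ≠ [] ∧ (∃ t, M.AcceptsAt p.1 t) ∧ ∃ t, M.HaltsAt p.1 t ∧ M.EmittedAt p.1 p.2 t}

/-- `M` is of time complexity `(tI, tO)`: on every pair of the transduction, the input is accepted
after at most `tI` steps, the output has been emitted completely after at most `tO` steps, and the
whole computation (acceptance and output) is over, that is, `M` has halted, after at most
`max tI tO` steps. -/
def HasTime (M : IAT A B) (tI tO : ℕ → ℕ) : Prop :=
  ∀ p ∈ M.transduction,
    (∃ t ≤ tI p.1.length, M.AcceptsAt p.1 t) ∧
    (∃ t ≤ tO p.1.length, M.EmittedAt p.1 p.2 t) ∧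
    (∃ t ≤ max (tI p.1.length) (tO p.1.length), M.HaltsAt p.1 t)

end IAT

/-! ### Families of transductions -/

/-- Real time for cellular automaton transducers: the function `n`. -/
def catRealTime : Set (ℕ → ℕ) := {fun n => n}

/-- Real time for iterative array transducers: the function `n + 1`. -/
def iatRealTime : Set (ℕ → ℕ) := {fun n => n + 1}

/-- Linear time: the functions `k * n` with `k ≥ 1` rational. -/
def linearTime : Set (ℕ → ℕ) := {t | ∃ k : ℚ, 1 ≤ k ∧ ∀ n : ℕ, t n = ⌊k * (n : ℚ)⌋₊}

/-- The transductions realized by cellular automaton transducers of time complexity `(tI, tO)`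
with `tI` in `I` and `tO` in `O`. -/
def catFamily (I O : Set (ℕ → ℕ)) : Set Transduction :=
  {T | ∃ M : CAT T.inAlph T.outAlph, ∃ tI ∈ I, ∃ tO ∈ O,
    M.HasTime tI tO ∧ M.transduction = T.pairs}

/-- The transductions computed by iterative array transducers of time complexity `(tI, tO)`
with `tI` in `I` and `tO` in `O`. -/
def iatFamily (I O : Set (ℕ → ℕ)) : Set Transduction :=
  {T | ∃ M : IAT T.inAlph T.outAlph, ∃ tI ∈ I, ∃ tO ∈ O,
    M.HasTime tI tO ∧ M.transduction = T.pairs}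

/-- The reversal transduction on nonempty words over a two-letter alphabet. -/
def reversalTransduction : Transduction where
  inAlph := Bool
  outAlph := Bool
  finite_in := inferInstance
  nonempty_in := inferInstance
  finite_out := inferInstance
  pairs := {p | p.1 ≠ [] ∧ p.2 = p.1.reverse}

/-! A CAT reverses in real time because every letter runs to the right border, is reflected there
and runs back, while a signal leaves the left border. Signal and returning letters meet at relative
speed two, so each cell picks up two consecutive letters, and `n` steps suffice.

An IAT emits at most `K` letters per step. To emit `2K + 1` letters within `2K + 2` steps it must
emit something before it has read the last letter, but the first letter of the reversal is that last
letter. The acceptance time plays no role.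

For the inclusion, the space-time diagram of the IAT is skewed. CAT cell `i` is responsible for a
bundle of consecutive IAT steps and holds the resulting row, which streams through it in blocks of
width `H + 4`; a window of three blocks of the left neighbour determines the next block. Each cell
lags two time units behind its left neighbour, so the origin reaches cell `i` in the step from time
`2i`. The input, shifted left meanwhile, then shows the letters `3i - 1`, `3i`, `3i + 1` around that
cell: the bundle consists of three steps. Bundles past the end of the input contain at least `H`
steps, which fits linear time into `n` cells (`mul_le_start`).

Cells far to the right would learn their output too late, but their bundles start after step `n +
1`, where a real-time IAT emits nothing more. They output the empty word once the shifted input has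
run out (`emitted_eq_none_or`, `exists_emitted`). A success mark found at the origin travels left to
the accepting cell. -/

namespace CAT

variable {A B : Type}

/-! ### Registers and neighbourhoods in a CAT -/

theorem out_persists (M : CAT A B) (w : List A) {t t' : ℕ} (h : t ≤ t') {i : Fin w.length}
    {u : List B} (hu : (M.run w t).out i = some u) : (M.run w t').out i = some u := by
  induction t', h using Nat.le_induction with
  | base => exact hu
  | succ s _ ih => simp [run, step, ih]

theorem out_unique (M : CAT A B) (w : List A) {t t' : ℕ} {i : Fin w.length}
    {u u' : List B} (hu : (M.run w t).out i = some u) (hu' : (M.run w t').out i = some u') :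
    u = u' := by
  have h1 := M.out_persists w (le_max_left t t') hu
  have h2 := M.out_persists w (le_max_right t t') hu'
  rw [h1] at h2
  exact Option.some.inj h2

theorem OutputsAt.unique {M : CAT A B} {w : List A} {v v' : List B} {t t' : ℕ}
    (h : M.OutputsAt w v t) (h' : M.OutputsAt w v' t') : v = v' := by
  obtain ⟨u, hu, rfl⟩ := h
  obtain ⟨u', hu', rfl⟩ := h'
  have : u = u' := funext fun i => M.out_unique w (hu i) (hu' i)
  rw [this]

/-- Closed forms of configurations are functions of a natural position; this and `rightOf_eq` remove
the `Fin` bookkeeping. -/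
theorem leftOf_eq (M : CAT A B) {n : ℕ} {c : Fin n → M.State} {g : ℕ → M.State}
    (h : ∀ i, c i = g i) (i : Fin n) :
    M.leftOf c i = if 0 < i.val then some (g (i - 1)) else none := by
  unfold leftOf
  split_ifs
  · rw [h]
  · rfl

theorem rightOf_eq (M : CAT A B) {n : ℕ} {c : Fin n → M.State} {g : ℕ → M.State}
    (h : ∀ i, c i = g i) (i : Fin n) :
    M.rightOf c i = if i.val + 1 < n then some (g (i + 1)) else none := by
  unfold rightOf
  split_ifs
  · rw [h]
  · rfl

end CAT

theorem List.ofFn_eq_map_range {α : Type*} (n : ℕ) (f : ℕ → α) :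
    List.ofFn (fun i : Fin n => f i) = (List.range n).map f := by
  apply List.ext_getElem <;> simp

/-! ### Reversal by a cellular automaton transducer -/

/-- The three components of a state are a right-moving track, a left-moving track that receives
the right-moving letters at the right border, and a mark left by a signal from the left border. -/
def reversalCAT : CAT Bool Bool where
  State := Option Bool × Option Bool × Bool
  finite_state := inferInstance
  accepting := Set.univ
  input := ⟨fun a => (some a, none, false), fun a b h => by simpa using h⟩
  delta l c r :=
    let newL := match r with
      | none => c.1
      | some d => d.2.1
    let sig := match l with
      | none => true
      | some d => d.2.2
    ((l.bind fun d => d.1, newL, sig),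
      if sig then some (c.2.1.toList ++ newL.toList) else none)

namespace reversalCAT

/-- The content of the left-moving track. -/
def left (w : List Bool) (i t : ℕ) : Option Bool :=
  -- Without the guard, truncated subtraction would repeat the first letter forever.
  if i + t + 1 ≤ 2 * w.length then w[2 * w.length - 1 - i - t]? else none

/-- The content of the right-moving track. -/
def right (w : List Bool) (i t : ℕ) : Option Bool :=
  if t ≤ i then w[i - t]? else none

/-- Letter `j` enters the left-moving track in cell `n - 1` at time `n - j`; from then on `i + t =
2n - 1 - j`. The mark reaches cell `i` at time `i + 1`. -/
theorem run_state (w : List Bool) (t : ℕ) (i : Fin w.length) :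
    (reversalCAT.run w t).state i = (right w i t, left w i t, decide (i.val < t)) := by
  induction t generalizing i with
  | zero =>
    have hi := i.isLt
    have h1 : w[2 * w.length - 1 - i.val]? = none := by
      rw [List.getElem?_eq_none_iff]; omega
    simp [CAT.run, CAT.init, reversalCAT, right, left, h1]
    rfl
  | succ t ih =>
    have hi := i.isLt
    have hl := CAT.leftOf_eq reversalCAT
      (g := fun i => (right w i t, left w i t, decide (i < t))) ih i
    have hr := CAT.rightOf_eq reversalCAT
      (g := fun i => (right w i t, left w i t, decide (i < t))) ih i
    simp only [CAT.run, CAT.step, CAT.localStep]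
    rw [hl, hr, ih]
    refine Prod.ext ?_ (Prod.ext ?_ ?_)
    · by_cases h0 : 0 < i.val
      · simp only [reversalCAT, h0, if_true, Option.bind_some, right]
        rcases Nat.lt_or_ge i.val (t + 1) with h | h
        · rw [if_neg (by omega), if_neg (by omega)]
        · rw [if_pos (by omega), if_pos (by omega)]
          congr 1; omega
      · simp only [reversalCAT, h0, if_false, Option.bind_none, right]
        rw [if_neg (by omega)]
    · by_cases h0 : i.val + 1 < w.length
      · simp only [reversalCAT, h0, if_true, left]
        congr 1
        · rw [eq_iff_iff]; omega
        · congr 1; omega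
      · simp only [reversalCAT, h0, if_false, right, left]
        by_cases ht : t ≤ i
        · rw [if_pos ht, if_pos (by omega)]
          congr 1; omega
        · rw [if_neg ht, if_neg (by omega)]
    · by_cases h0 : 0 < i.val
      · simp only [reversalCAT, h0, if_true]
        rw [decide_eq_decide]; omega
      · simp only [reversalCAT, h0, if_false]
        symm; rw [decide_eq_true_eq]; omega

/-- The output of the cell `i`. -/
def word (w : List Bool) (i : ℕ) : List Bool :=
  (left w i i).toList ++ (left w i (i + 1)).toList

/-- The register is filled in the step in which the mark arrives, with the left-moving letters seen
just before and just after that step. -/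
theorem run_out (w : List Bool) (t : ℕ) (i : Fin w.length) :
    (reversalCAT.run w t).out i = if i.val < t then some (word w i) else none := by
  induction t with
  | zero => simp [CAT.run, CAT.init]
  | succ t ih =>
    have h1 := run_state w (t + 1) i
    simp only [CAT.run, CAT.step] at h1
    have hsnd : (reversalCAT.localStep (reversalCAT.run w t).state i).2 =
        if (reversalCAT.localStep (reversalCAT.run w t).state i).1.2.2 then
          some (((reversalCAT.run w t).state i).2.1.toList ++
            (reversalCAT.localStep (reversalCAT.run w t).state i).1.2.1.toList)
        else none := rfl
    rw [h1, run_state] at hsnd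
    simp only [CAT.run, CAT.step, ih, hsnd]
    rcases lt_trichotomy i.val t with h | h | h
    · simp [h, Nat.lt_succ_of_lt h]
    · subst h
      simp [word]
    · simp [Nat.not_lt.2 h.le, Nat.not_lt.2 h]

theorem flatten_words (w : List Bool) :
    ((List.range w.length).map (word w)).flatten = w.reverse := by
  -- Invariant: the first `m` cells output everything but the prefix of length `2(n - m)`. A length
  -- beyond `n` is harmless for `take`, which covers the cells with empty words.
  have key : ∀ m ≤ w.length, ((List.range m).map (word w)).flatten ++
      (w.take (2 * (w.length - m))).reverse = w.reverse := by
    intro m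
    induction m with
    | zero =>
      intro _
      simp [List.take_of_length_le (show w.length ≤ 2 * w.length by omega)]
    | succ m ih =>
      intro hm
      rw [← ih (by omega)]
      have e : 2 * (w.length - m) = 2 * (w.length - (m + 1)) + 1 + 1 := by omega
      have e1 : left w m m = w[2 * (w.length - (m + 1)) + 1]? := by
        rw [left, if_pos (by omega)]; congr 1; omega
      have e2 : left w m (m + 1) = w[2 * (w.length - (m + 1))]? := by
        rw [left, if_pos (by omega)]; congr 1; omega
      have hrev : ∀ o : Option Bool, o.toList.reverse = o.toList := by rintro (_ | _) <;> rfl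
      rw [e, List.take_add_one, List.take_add_one, List.range_succ]
      simp [word, e1, e2, hrev]
  simpa using key w.length le_rfl

theorem outputsAt (w : List Bool) : reversalCAT.OutputsAt w w.reverse w.length := by
  refine ⟨fun i => word w i, fun i => ?_, ?_⟩
  · rw [run_out, if_pos i.isLt]
  · rw [List.ofFn_eq_map_range, flatten_words]

theorem acceptsAt {w : List Bool} (hw : w ≠ []) : reversalCAT.AcceptsAt w 0 :=
  ⟨List.length_pos_iff.2 hw, Set.mem_univ _⟩

theorem transduction_eq : reversalCAT.transduction = reversalTransduction.pairs := by
  ext ⟨w, v⟩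
  constructor
  · rintro ⟨hw, -, t, ht⟩
    exact ⟨hw, ht.unique (outputsAt w)⟩
  · rintro ⟨hw, hv⟩
    refine ⟨hw, ⟨0, acceptsAt hw⟩, w.length, ?_⟩
    dsimp only at hv ⊢
    rw [hv]
    exact outputsAt w

theorem hasTime (tI : ℕ → ℕ) : reversalCAT.HasTime tI fun n => n := by
  rintro ⟨w, v⟩ ⟨hw, -, -⟩
  refine ⟨⟨0, Nat.zero_le _, acceptsAt hw⟩, w.length, le_rfl, fun i => ?_⟩
  rw [run_out, if_pos i.isLt]
  simp

end reversalCAT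

theorem reversal_mem_catFamily {I : Set (ℕ → ℕ)} (hI : I.Nonempty) :
    reversalTransduction ∈ catFamily I catRealTime := by
  obtain ⟨tI, hI⟩ := hI
  exact ⟨reversalCAT, tI, hI, _, rfl, reversalCAT.hasTime tI, reversalCAT.transduction_eq⟩

/-! ### Iterative array transducers -/

namespace IAT

variable {A B : Type}

theorem run_succ_eq_some {M : IAT A B} {w : List A} {t : ℕ} {C' : M.Config}
    (h : M.run w (t + 1) = some C') :
    ∃ C, M.run w t = some C ∧ M.step w[t]? C = some C' := by
  simpa [run, Option.bind_eq_some_iff] using h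

theorem run_eq_none_mono {M : IAT A B} {w : List A} {t t' : ℕ} (h : t ≤ t')
    (ht : M.run w t = none) : M.run w t' = none := by
  induction t', h using Nat.le_induction with
  | base => exact ht
  | succ s _ ih => simp [run, ih]

theorem run_eq_some_of_le {M : IAT A B} {w : List A} {t t' : ℕ} (h : t ≤ t') {C' : M.Config}
    (ht : M.run w t' = some C') : ∃ C, M.run w t = some C := by
  cases hC : M.run w t with
  | none => rw [run_eq_none_mono h hC] at ht; cases ht
  | some C => exact ⟨C, rfl⟩

theorem step_out {M : IAT A B} {x : Option A} {C C' : M.Config} (h : M.step x C = some C') :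
    ∃ r, M.delta0 x (C.state 0) (C.state 1) = some r ∧ C'.out = C.out ++ r.1 := by
  simp only [step, Option.map_eq_some_iff] at h
  obtain ⟨r, hr, rfl⟩ := h
  exact ⟨r, hr, rfl⟩

theorem out_prefix {M : IAT A B} {w : List A} {t t' : ℕ} (h : t ≤ t') {C C' : M.Config}
    (hC : M.run w t = some C) (hC' : M.run w t' = some C') : C.out <+: C'.out := by
  induction t', h using Nat.le_induction generalizing C' with
  | base => rw [hC] at hC'; cases hC'; exact List.prefix_rfl
  | succ s _ ih =>
    obtain ⟨D, hD, hs⟩ := run_succ_eq_some hC'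
    obtain ⟨r, -, hr⟩ := step_out hs
    exact (ih hD).trans (hr ▸ List.prefix_append _ _)

theorem HaltsAt.le {M : IAT A B} {w : List A} {t T : ℕ} (hT : M.HaltsAt w T) {C : M.Config}
    (hC : M.run w t = some C) : t ≤ T := by
  by_contra hlt
  rw [run_eq_none_mono (not_le.1 hlt) hT.2] at hC
  cases hC

theorem exists_output_bound [Finite A] (M : IAT A B) :
    ∃ K, ∀ x c d r, M.delta0 x c d = some r → r.1.length ≤ K := by
  have := M.finite_state
  let f : Option A × M.State × M.State → ℕ := fun p =>
    ((M.delta0 p.1 p.2.1 p.2.2).elim [] fun r => r.1).length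
  obtain ⟨K, hK⟩ := (Set.finite_range f).bddAbove
  refine ⟨K, fun x c d r h => ?_⟩
  simpa [f, h] using hK ⟨(x, c, d), rfl⟩

theorem out_length_le {M : IAT A B} {K : ℕ}
    (hK : ∀ x c d r, M.delta0 x c d = some r → r.1.length ≤ K) {w : List A} {t t' : ℕ}
    (h : t ≤ t') {C C' : M.Config} (hC : M.run w t = some C) (hC' : M.run w t' = some C') :
    C'.out.length ≤ C.out.length + (t' - t) * K := by
  induction t', h using Nat.le_induction generalizing C' with
  | base => rw [hC] at hC'; cases hC'; simp
  | succ s hs ih =>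
    obtain ⟨D, hD, hst⟩ := run_succ_eq_some hC'
    obtain ⟨r, hr, hout⟩ := step_out hst
    have h1 := ih hD
    have h2 := hK _ _ _ _ hr
    rw [hout, List.length_append, Nat.succ_sub hs, Nat.succ_mul]
    omega

theorem run_congr (M : IAT A B) {w w' : List A} {t : ℕ} (h : ∀ k < t, w[k]? = w'[k]?) :
    M.run w t = M.run w' t := by
  induction t with
  | zero => rfl
  | succ t ih => rw [run, run, ih fun k hk => h k (by omega), h t (by omega)]

/-! ### Reversal defeats real-time output -/

theorem not_hasTime_of_reversal {M : IAT Bool Bool}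
    (hM : M.transduction = reversalTransduction.pairs) (tI : ℕ → ℕ) :
    ¬ M.HasTime tI fun n => n + 1 := by
  intro hT
  obtain ⟨K, hK⟩ := M.exists_output_bound
  -- Two inputs differing only in the last letter, which is unread at time `2K`. At most two steps,
  -- hence at most `2K` letters, remain after that.
  set W : Bool → List Bool := fun b => List.replicate (2 * K) false ++ [b] with hW
  have hmem : ∀ b, (W b, (W b).reverse) ∈ M.transduction := fun b => by
    rw [hM]; exact ⟨by simp [hW], rfl⟩
  obtain ⟨t, ht, C, hC, hout⟩ := (hT _ (hmem false)).2.1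
  have hlen : (W false).length = 2 * K + 1 := by simp [hW]
  dsimp only at ht hC hout
  rw [hlen] at ht
  obtain ⟨D, hD⟩ := run_eq_some_of_le (min_le_left t (2 * K)) hC
  have hne : 0 < D.out.length := by
    have h1 := out_length_le hK (min_le_left t (2 * K)) hD hC
    rw [hout, List.length_reverse, hlen] at h1
    have h2 : (t - min t (2 * K)) * K ≤ 2 * K := Nat.mul_le_mul_right _ (by omega)
    omega
  -- The runs on both inputs agree so far, so the same nonempty output would begin with either
  -- letter.
  have hhead : ∀ b, D.out.head? = some b := by
    intro b
    have hD' : M.run (W b) (min t (2 * K)) = some D := by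
      rw [← hD]
      refine run_congr M fun k hk => ?_
      have hk' : k < 2 * K := by omega
      simp [hW, List.getElem?_append, hk']
    obtain ⟨-, -, T, hT, C', hC', hout'⟩ := hmem b
    obtain ⟨u, hu⟩ := out_prefix (hT.le hD') hD' hC'
    dsimp only at hout'
    rw [hout'] at hu
    obtain ⟨x, l, hx⟩ := List.exists_cons_of_length_pos hne
    rw [hx] at hu ⊢
    simp [hW] at hu
    simp [hu.1]
  have := (hhead false).symm.trans (hhead true)
  simp at this

end IAT

theorem reversal_notMem_iatFamily (I : Set (ℕ → ℕ)) :
    reversalTransduction ∉ iatFamily I iatRealTime := by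
  rintro ⟨M, tI, -, tO, rfl, hT, hM⟩
  exact IAT.not_hasTime_of_reversal hM tI hT

/-! ### The rows of the space-time diagram of an iterative array -/

namespace IAT

variable {A B : Type}

/-- A cell of an iterative array whose cells are extended to the left by void cells `none`. The
communication cell is the only cell with a void left neighbour. The first component is `none` if
the array has halted, or if the cell has been influenced by that; the second component records
whether the communication cell has been accepting so far. -/
abbrev Cell (M : IAT A B) : Type := Option (Option M.State × Bool)

/-- The partial transition function of the communication cell, for possibly undefined states. -/
def commStep (M : IAT A B) (x : Option A) (c r : Option M.State) : Option (List B × M.State) :=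
  c.bind fun c => r.bind fun r => M.delta0 x c r

open Classical in
/-- The transition function for all cells. -/
noncomputable def rule (M : IAT A B) (x : Option A) (l c r : M.Cell) : M.Cell :=
  c.map fun c => match l with
    | none =>
      let c' := (M.commStep x c.1 (r.bind Prod.fst)).map Prod.snd
      (c', c.2 || c'.any fun s => s ∈ M.accepting)
    | some l => (l.1.bind fun a => c.1.bind fun b => (r.bind Prod.fst).map fun d => M.delta a b d,
        false)

/-- The word emitted by a communication cell `c` with right neighbour `r`. -/
def emit (M : IAT A B) (x : Option A) (c r : M.Cell) : List B :=
  ((M.commStep x (c.bind Prod.fst) (r.bind Prod.fst)).map Prod.fst).getD []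

/-- One step of the extended array. -/
noncomputable def stepRow (M : IAT A B) (x : Option A) (f : ℤ → M.Cell) : ℤ → M.Cell :=
  fun j => M.rule x (f (j - 1)) (f j) (f (j + 1))

/-- The steps of the extended array that read the given symbols. -/
noncomputable def advance (M : IAT A B) : List (Option A) → (ℤ → M.Cell) → ℤ → M.Cell
  | [], f => f
  | x :: xs, f => M.advance xs (M.stepRow x f)

/-- The word emitted in these steps by the communication cell at position `p`. -/
noncomputable def emission (M : IAT A B) : List (Option A) → (ℤ → M.Cell) → ℤ → List B
  | [], _, _ => []
  | x :: xs, f, p => M.emit x (f p) (f (p + 1)) ++ M.emission xs (M.stepRow x f) p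

open Classical in
/-- The initial row. -/
noncomputable def initRow (M : IAT A B) (j : ℤ) : M.Cell :=
  -- The flag is the same in all cells, so that the initial row is constant on nonnegative
  -- positions.
  if j < 0 then none else some (some M.quiescent, decide (M.quiescent ∈ M.accepting))

/-- The extended array after `s` steps on the input `w`. -/
noncomputable def row (M : IAT A B) (w : List A) : ℕ → ℤ → M.Cell
  | 0 => M.initRow
  | s + 1 => M.stepRow w[s]? (M.row w s)

/-- The output emitted in the first `s` steps on the input `w`. -/
noncomputable def total (M : IAT A B) (w : List A) : ℕ → List B
  | 0 => []
  | s + 1 => M.total w s ++ M.emit w[s]? (M.row w s 0) (M.row w s 1)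

variable (M : IAT A B)

/-! ### Locality and translation invariance of the extended array -/

theorem rule_eq_none_iff {x : Option A} {l c r : M.Cell} : M.rule x l c r = none ↔ c = none := by
  simp [rule]

/-- Void cells are never created or destroyed, so any window reveals where it lies relative to the
origin. -/
theorem row_eq_none_iff {w : List A} {s : ℕ} {j : ℤ} : M.row w s j = none ↔ j < 0 := by
  induction s generalizing j with
  | zero => simp [row, initRow]
  | succ s ih => rw [row, stepRow, rule_eq_none_iff, ih]

theorem advance_eq_none_iff {xs : List (Option A)} {f : ℤ → M.Cell} {j : ℤ} :
    M.advance xs f j = none ↔ f j = none := by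
  induction xs generalizing f with
  | nil => rfl
  | cons x xs ih => rw [advance, ih, stepRow, rule_eq_none_iff]

theorem stepRow_congr {x : Option A} {f f' : ℤ → M.Cell} {a b : ℤ}
    (h : ∀ k, a - 1 ≤ k → k ≤ b + 1 → f k = f' k) :
    ∀ k, a ≤ k → k ≤ b → M.stepRow x f k = M.stepRow x f' k := by
  intro k hk hk'
  rw [stepRow, stepRow, h _ (by omega) (by omega), h k (by omega) (by omega),
    h (k + 1) (by omega) (by omega)]

theorem advance_congr {xs : List (Option A)} {f f' : ℤ → M.Cell} {a b : ℤ}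
    (h : ∀ k, a - xs.length ≤ k → k ≤ b + xs.length → f k = f' k) :
    ∀ k, a ≤ k → k ≤ b → M.advance xs f k = M.advance xs f' k := by
  induction xs generalizing f f' with
  | nil => intro k hk hk'; exact h k (by simpa using hk) (by simpa using hk')
  | cons x xs ih =>
    refine ih (M.stepRow_congr fun k hk hk' => h k ?_ ?_) <;>
      rw [List.length_cons] <;> push_cast <;> omega

theorem emission_congr {xs : List (Option A)} {f f' : ℤ → M.Cell} {p : ℤ}
    (h : ∀ k, p - xs.length ≤ k → k ≤ p + xs.length → f k = f' k) :
    M.emission xs f p = M.emission xs f' p := by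
  induction xs generalizing f f' with
  | nil => rfl
  | cons x xs ih =>
    simp only [List.length_cons, Nat.cast_add, Nat.cast_one] at h
    rw [emission, emission, h p (by omega) (by omega), h (p + 1) (by omega) (by omega),
      ih (M.stepRow_congr fun k hk hk' => h k (by omega) (by omega))]

/-- The communication cell is recognised by its void left neighbour, not by its position; hence the
rule can be applied to windows in relative coordinates. -/
theorem stepRow_shift (x : Option A) (f : ℤ → M.Cell) (c : ℤ) :
    M.stepRow x (fun k => f (c + k)) = fun k => M.stepRow x f (c + k) := by
  funext k
  simp only [stepRow, add_assoc, add_sub_assoc]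

theorem advance_shift (xs : List (Option A)) (f : ℤ → M.Cell) (c : ℤ) :
    M.advance xs (fun k => f (c + k)) = fun k => M.advance xs f (c + k) := by
  induction xs generalizing f with
  | nil => rfl
  | cons x xs ih => rw [advance, stepRow_shift, ih]; rfl

theorem emission_shift (xs : List (Option A)) (f : ℤ → M.Cell) (c p : ℤ) :
    M.emission xs (fun k => f (c + k)) p = M.emission xs f (c + p) := by
  induction xs generalizing f with
  | nil => rfl
  | cons x xs ih => rw [emission, stepRow_shift, ih, emission, add_assoc]

/-! ### Rows, runs and total output -/

theorem advance_row (w : List A) (s m : ℕ) :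
    M.advance ((List.range m).map fun k => w[s + k]?) (M.row w s) = M.row w (s + m) := by
  induction m generalizing s with
  | zero => rfl
  | succ m ih =>
    rw [List.range_succ_eq_map, List.map_cons, List.map_map, advance]
    have := ih (s + 1)
    rw [row, show s + 1 + m = s + (m + 1) by omega] at this
    rw [← this]
    congr 2
    funext k
    simp [Nat.add_assoc, Nat.add_comm 1]

theorem total_add (w : List A) (s m : ℕ) :
    M.total w (s + m) = M.total w s ++
      M.emission ((List.range m).map fun k => w[s + k]?) (M.row w s) 0 := by
  induction m generalizing s with
  | zero => simp [emission]
  | succ m ih =>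
    rw [List.range_succ_eq_map, List.map_cons, List.map_map, emission]
    have := ih (s + 1)
    rw [total, row, show s + 1 + m = s + (m + 1) by omega, List.append_assoc] at this
    rw [this]
    congr 3
    refine congrArg (fun g => List.map g (List.range m)) ?_
    funext k
    simp [Nat.add_assoc, Nat.add_comm 1]

theorem total_prefix (w : List A) {s s' : ℕ} (h : s ≤ s') : M.total w s <+: M.total w s' := by
  obtain ⟨m, rfl⟩ := Nat.exists_eq_add_of_le h
  rw [total_add]
  exact List.prefix_append _ _

open Classical in
/-- What a row says about the run of the array. -/
theorem row_spec (w : List A) (s : ℕ) :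
    (∀ C, M.run w s = some C →
      (∀ j : ℕ, ∃ b, M.row w s j = some (some (C.state j), b)) ∧ M.total w s = C.out) ∧
    ∃ c b, M.row w s 0 = some (c, b) ∧ (c = none ↔ M.run w s = none) ∧
      (b = true ↔ ∃ t ≤ s, M.AcceptsAt w t) := by
  induction s with
  | zero =>
    refine ⟨?_, some M.quiescent, _, rfl, by simp [run], ?_⟩
    · rintro C hC
      cases hC
      exact ⟨fun j => ⟨_, (if_neg (by omega) : M.initRow j = _)⟩, rfl⟩
    · simp [AcceptsAt, run]
  | succ s ih =>
    obtain ⟨ih, c, b, hrow, hc, hb⟩ := ih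
    have hneg : M.row w s (0 - 1) = none := M.row_eq_none_iff.2 (by norm_num)
    have hacc : (∃ t ≤ s + 1, M.AcceptsAt w t) ↔
        (∃ t ≤ s, M.AcceptsAt w t) ∨ M.AcceptsAt w (s + 1) := by
      constructor
      · rintro ⟨t, ht, h⟩
        rcases Nat.lt_or_ge s t with h1 | h1
        · exact Or.inr (by rwa [show s + 1 = t by omega])
        · exact Or.inl ⟨t, h1, h⟩
      · rintro (⟨t, ht, h⟩ | h)
        · exact ⟨t, by omega, h⟩
        · exact ⟨s + 1, le_rfl, h⟩
    cases hs : M.run w s with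
    | none =>
      have hs' : M.run w (s + 1) = none := run_eq_none_mono (Nat.le_succ s) hs
      have hna : ¬ M.AcceptsAt w (s + 1) := by rintro ⟨C, hC, -⟩; rw [hs'] at hC; cases hC
      refine ⟨fun C hC => (by rw [hs'] at hC; cases hC), none, b, ?_, by simp [hs'], ?_⟩
      · rw [row, stepRow, hneg, hrow, hc.2 hs]
        simp [rule, commStep]
      · simp only [hacc, hb, hna, or_false]
    | some C =>
      obtain ⟨hst, htot⟩ := ih C hs
      obtain ⟨b0, h0⟩ := hst 0
      obtain ⟨b1, h1⟩ := hst 1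
      have e0 : M.row w s 0 = some (some (C.state 0), b0) := h0
      have e1 : M.row w s (0 + 1) = some (some (C.state 1), b1) := h1
      obtain rfl : b0 = b := by rw [hrow] at e0; simp_all
      have hrun : M.run w (s + 1) = M.step w[s]? C := by rw [run, hs]; rfl
      have hcs : M.commStep w[s]? (some (C.state 0)) (some (C.state 1)) =
        M.delta0 w[s]? (C.state 0) (C.state 1) := rfl
      have hz : M.row w (s + 1) 0 =
          M.rule w[s]? none (some (some (C.state 0), b0)) (some (some (C.state 1), b1)) := by
        rw [row, stepRow, hneg, e0, e1]
      cases hd : M.delta0 w[s]? (C.state 0) (C.state 1) with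
      | none =>
        have hs' : M.run w (s + 1) = none := by rw [hrun, step, hd]; rfl
        have hna : ¬ M.AcceptsAt w (s + 1) := by rintro ⟨C, hC, -⟩; rw [hs'] at hC; cases hC
        refine ⟨fun C hC => (by rw [hs'] at hC; cases hC), none, b0, ?_, by simp [hs'], ?_⟩
        · rw [hz]
          simp [rule, hcs, hd]
        · simp only [hacc, hb, hna, or_false]
      | some r =>
        have hs' : M.run w (s + 1) = some
            { state := fun i =>
                match i with
                | 0 => r.2
                | j + 1 => M.delta (C.state j) (C.state (j + 1)) (C.state (j + 2))
              out := C.out ++ r.1 } := by rw [hrun, step, hd]; rfl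
        have hz' : M.row w (s + 1) 0 = some (some r.2, b0 || decide (r.2 ∈ M.accepting)) := by
          rw [hz]
          simp [rule, hcs, hd]
        refine ⟨fun C' hC' => ?_, some r.2, _, hz', by simp [hs'], ?_⟩
        · rw [hs'] at hC'
          cases hC'
          refine ⟨fun j => ?_, ?_⟩
          · cases j with
            | zero => exact ⟨_, hz'⟩
            | succ j =>
              obtain ⟨b, hb⟩ := hst j
              obtain ⟨b', hb'⟩ := hst (j + 1)
              obtain ⟨b'', hb''⟩ := hst (j + 2)
              refine ⟨false, ?_⟩
              rw [row, stepRow, show ((j + 1 : ℕ) : ℤ) - 1 = j by omega, hb, hb',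
                show ((j + 1 : ℕ) : ℤ) + 1 = (j + 2 : ℕ) by omega, hb'']
              rfl
          · rw [zero_add] at e1
            rw [total, htot, e0, e1]
            simp [emit, hcs, hd]
        · rw [hacc, ← hb]
          simp [AcceptsAt, hs']

theorem exists_haltsAt {w : List A} {s : ℕ} (h : M.run w s = none) : ∃ t, M.HaltsAt w t := by
  classical
  have hex : ∃ s, M.run w s = none := ⟨s, h⟩
  obtain ⟨t, ht⟩ : ∃ t, Nat.find hex = t + 1 :=
    Nat.exists_eq_succ_of_ne_zero fun h0 => by
      have := Nat.find_spec hex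
      rw [h0] at this
      cases this
  refine ⟨t, Option.ne_none_iff_exists'.1 (Nat.find_min hex (by omega)), ?_⟩
  rw [← ht]
  exact Nat.find_spec hex

/-- No acceptance can occur once the array has halted, so the flag is then final. -/
theorem row_zero_eq_iff {w : List A} {s : ℕ} :
    M.row w s 0 = some (none, true) ↔
      M.run w s = none ∧ ∃ t, M.AcceptsAt w t := by
  obtain ⟨-, c, b, hrow, hc, hb⟩ := M.row_spec w s
  rw [hrow]
  simp only [Option.some.injEq, Prod.mk.injEq, hc, hb]
  refine and_congr_right fun hn => ⟨fun ⟨t, _, h⟩ => ⟨t, h⟩, fun ⟨t, h⟩ => ⟨t, ?_, h⟩⟩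
  by_contra hlt
  obtain ⟨C, hC, -⟩ := h
  rw [run_eq_none_mono (not_le.1 hlt).le hn] at hC
  cases hC

/-- Every step resets the flag of all cells except the communication cell, so success can be
detected without knowing the position. -/
theorem eq_zero_of_row_eq {w : List A} {s : ℕ} (hs : 0 < s) {j : ℤ} :
    M.row w s j = some (none, true) → j = 0 := by
  intro h
  obtain ⟨s, rfl⟩ := Nat.exists_eq_succ_of_ne_zero hs.ne'
  by_contra hj
  have h0 : ¬ j < 0 := fun h0 => by rw [M.row_eq_none_iff.2 h0] at h; cases h
  obtain ⟨l, hl⟩ := Option.ne_none_iff_exists'.1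
    (mt (M.row_eq_none_iff (w := w) (s := s) (j := j - 1)).1 (by omega))
  obtain ⟨c, hc⟩ := Option.ne_none_iff_exists'.1
    (mt (M.row_eq_none_iff (w := w) (s := s) (j := j)).1 h0)
  rw [row, stepRow, hl, hc] at h
  simp [rule] at h

/-- After halting the output does not change. -/
theorem total_of_haltsAt {w : List A} {t s : ℕ} (h : M.HaltsAt w t) (hs : t ≤ s) :
    M.total w s = M.total w t := by
  induction s, hs using Nat.le_induction with
  | base => rfl
  | succ s hs ih =>
    have hn : M.run w (s + 1) = none := run_eq_none_mono (Nat.succ_le_succ hs) h.2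
    obtain ⟨hC, c, b, hrow, hc, -⟩ := M.row_spec w s
    suffices M.commStep w[s]? ((M.row w s 0).bind Prod.fst) ((M.row w s 1).bind Prod.fst) = none by
      rw [total, emit, this, ih]; simp
    cases hr : M.run w s with
    | none => simp [hrow, hc.2 hr, commStep]
    | some C =>
      obtain ⟨b0, h0⟩ := (hC C hr).1 0
      obtain ⟨b1, h1⟩ := (hC C hr).1 1
      rw [Nat.cast_zero] at h0
      rw [Nat.cast_one] at h1
      rw [run, hr] at hn
      simpa [h0, h1, commStep, step] using hn

/-- The total output grows by prefixes and equals `v` both at some time at most `n + 1` and at the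
halting time, so it is `v` in between and stays so. -/
theorem total_eq_of_hasTime {tI : ℕ → ℕ} (hT : M.HasTime tI fun n => n + 1) {w : List A}
    {v : List B} (h : (w, v) ∈ M.transduction) {s : ℕ} (hs : w.length + 1 ≤ s) :
    M.total w s = v := by
  obtain ⟨t, ht, C, hC, hCv⟩ := (hT _ h).2.1
  obtain ⟨-, -, T, hh, D, hD, hDv⟩ := h
  dsimp only at ht hC hCv hh hD hDv
  have h1 : M.total w t = v := (((M.row_spec w t).1 C hC).2).trans hCv
  have h2 : M.total w T = v := (((M.row_spec w T).1 D hD).2).trans hDv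
  rcases le_total T s with h3 | h3
  · rw [M.total_of_haltsAt hh h3, h2]
  · have p1 := M.total_prefix w (ht.trans hs)
    have p2 := M.total_prefix w h3
    rw [h1] at p1
    rw [h2] at p2
    exact (p1.eq_of_length (le_antisymm p1.length_le p2.length_le)).symm

end IAT

/-! ### Simulation of an iterative array transducer by a cellular automaton transducer -/

namespace IAT

variable {A B : Type}

/-- Three consecutive input symbols; the first one is missing for the leftmost cell. -/
abbrev Triple (A : Type) : Type := Option (Option A) × Option A × Option A

/-- The input symbols that are read in the row of a cell: if the third symbol is the end-of-input
symbol, it is read `H` times. -/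
def symbols (H : ℕ) (m : Triple A) : List (Option A) :=
  m.1.toList ++ m.2.1 :: m.2.2.elim (List.replicate H none) fun a => [some a]

/-- The input symbols that the cell `i` collects. -/
def tripleAt (w : List A) (i : ℕ) : Triple A :=
  (if i = 0 then none else some w[3 * i - 1]?, w[3 * i]?, w[3 * i + 1]?)

/-- The number of steps performed in the rows of the first `i` cells. -/
def start (H : ℕ) (w : List A) : ℕ → ℕ
  | 0 => 0
  | i + 1 => start H w i + (symbols H (tripleAt w i)).length

/-! ### Counting the steps of the bundles -/

theorem length_symbols (H : ℕ) (m : Triple A) :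
    (symbols H m).length = m.1.toList.length + 1 + m.2.2.elim H fun _ => 1 := by
  rcases m with ⟨_ | _, _, _ | _⟩ <;> simp [symbols] <;> omega

theorem length_symbols_lt (H : ℕ) (m : Triple A) : (symbols H m).length < H + 4 := by
  rcases m with ⟨_ | _, _, _ | _⟩ <;> simp [symbols]

theorem length_tripleAt (w : List A) (i : ℕ) :
    (tripleAt w i).1.toList.length = if i = 0 then 0 else 1 := by
  unfold tripleAt
  split_ifs <;> rfl

theorem start_succ (H : ℕ) (w : List A) (i : ℕ) :
    start H w (i + 1) = start H w i + ((if i = 0 then 0 else 1) + 1 +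
      if 3 * i + 1 < w.length then 1 else H) := by
  rw [start, length_symbols, length_tripleAt]
  congr 2
  split_ifs with h
  · simp [tripleAt, h]
  · simp [tripleAt, List.getElem?_eq_none (Nat.not_lt.1 h)]

/-- The first bundle has at least two steps, every other one at least three. -/
theorem le_start {H : ℕ} (hH : 0 < H) (w : List A) (i : ℕ) : 3 * i ≤ start H w i + 1 := by
  induction i with
  | zero => omega
  | succ i ih =>
    rw [start_succ]
    rcases Nat.eq_zero_or_pos i with rfl | hi
    · simp only [start]; split_ifs <;> omega
    · rw [if_neg hi.ne']
      split_ifs <;> omega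

/-- Bundles are of size two, then exactly three, as long as their third symbol is an input letter.
-/
theorem start_eq {H : ℕ} {w : List A} {i : ℕ} (hi : 0 < i) (h : 3 * i ≤ w.length + 1) :
    start H w i + 1 = 3 * i := by
  induction i, hi using Nat.le_induction with
  | base =>
    rw [start_succ, if_pos rfl, if_pos (by omega)]
    rfl
  | succ i hi ih =>
    have := ih (by omega)
    rw [start_succ, if_neg (by omega), if_pos (by omega)]
    omega

theorem start_mono {H : ℕ} (w : List A) : Monotone (start H w) :=
  monotone_nat_of_le_succ fun _ => Nat.le_add_right _ _

/-- At most `(n + 1) / 3` bundles have an input letter as third symbol; each of the others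
contributes at least `H` steps. -/
theorem mul_le_start (H : ℕ) (w : List A) (i : ℕ) :
    H * i ≤ start H w i + H * ((w.length + 1) / 3) := by
  induction i with
  | zero => simp
  | succ i ih =>
    rcases Nat.lt_or_ge (3 * i + 1) w.length with h | h
    · exact (Nat.mul_le_mul_left H (by omega)).trans (Nat.le_add_left _ _)
    · rw [start_succ, if_neg (Nat.not_lt.2 h), Nat.mul_succ]
      omega

/-- Collected symbols are the ones the array reads: by `start_eq` inside the input, and past its end
both sides are end-of-input symbols. -/
theorem symbols_tripleAt {H : ℕ} (hH : 0 < H) (w : List A) (i : ℕ) :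
    symbols H (tripleAt w i) =
      (List.range (symbols H (tripleAt w i)).length).map fun k => w[start H w i + k]? := by
  have hnone : w.length ≤ 3 * i + 1 → symbols H (tripleAt w i) =
      (tripleAt w i).1.toList ++ w[3 * i]? :: List.replicate H none := fun h => by
    simp [symbols, tripleAt, List.getElem?_eq_none h]
  have hsome : 3 * i + 1 < w.length → symbols H (tripleAt w i) =
      (tripleAt w i).1.toList ++ [w[3 * i]?, w[3 * i + 1]?] := fun h => by
    simp [symbols, tripleAt, h]
  apply List.ext_getElem
  · simp
  intro k hk _
  rw [List.getElem_map, List.getElem_range]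
  rcases Nat.eq_zero_or_pos i with rfl | hi
  · have h1 : (tripleAt w 0).1.toList = [] := rfl
    rw [h1] at hnone hsome
    rcases Nat.lt_or_ge (3 * 0 + 1) w.length with h | h
    · simp only [hsome h]
      rw [hsome h] at hk
      rcases k with _ | _ | k
      · simp [start]
      · simp [start]
      · simp at hk
    · simp only [hnone h]
      rcases k with _ | k
      · simp [start]
      · simp only [List.nil_append, List.getElem_cons_succ, List.getElem_replicate]
        rw [List.getElem?_eq_none (by omega)]
  · have h1 : (tripleAt w i).1.toList = [w[3 * i - 1]?] := by simp [tripleAt, hi.ne']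
    rw [h1] at hnone hsome
    have hs := le_start hH w i
    rcases Nat.lt_or_ge (3 * i + 1) w.length with h | h
    · have hs' := start_eq (H := H) (w := w) hi (by omega)
      simp only [hsome h]
      rw [hsome h] at hk
      rcases k with _ | _ | _ | k
      · simp [show start H w i = 3 * i - 1 by omega]
      · simp [hs']
      · simp [← hs']
      · simp at hk; omega
    · simp only [hnone h]
      rcases Nat.lt_or_ge w.length (3 * i - 1) with h' | h'
      · rw [List.getElem?_eq_none (i := start H w i + k) (by omega)]
        rcases k with _ | _ | k
        · exact List.getElem?_eq_none (by omega)
        · exact List.getElem?_eq_none (by omega)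
        · simp
      · have hs' := start_eq (H := H) (w := w) hi (by omega)
        rcases k with _ | _ | k
        · simp [show start H w i = 3 * i - 1 by omega]
        · simp [hs']
        · rw [List.getElem?_eq_none (i := start H w i + (k + 1 + 1)) (by omega)]
          simp

variable (M : IAT A B)

theorem advance_symbols {H : ℕ} (hH : 0 < H) (w : List A) (i : ℕ) :
    M.advance (symbols H (tripleAt w i)) (M.row w (start H w i)) = M.row w (start H w (i + 1)) := by
  rw [symbols_tripleAt hH, advance_row, start]

/-- The word emitted in the row of the cell `i`. -/
noncomputable def wordAt (H : ℕ) (w : List A) (i : ℕ) : List B :=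
  M.emission (symbols H (tripleAt w i)) (M.row w (start H w i)) 0

theorem total_start_succ {H : ℕ} (hH : 0 < H) (w : List A) (i : ℕ) :
    M.total w (start H w (i + 1)) = M.total w (start H w i) ++ M.wordAt H w i := by
  rw [wordAt, symbols_tripleAt hH, start, total_add]

theorem flatten_wordAt {H : ℕ} (hH : 0 < H) (w : List A) (n : ℕ) :
    ((List.range n).map (M.wordAt H w)).flatten = M.total w (start H w n) := by
  induction n with
  | zero => rfl
  | succ n ih => rw [List.range_succ, total_start_succ M hH]; simp [ih]

/-- The states of the simulating automaton: the current symbol of the input shifted to the left,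
the symbols collected, a window of three blocks of the row of the cell, and a mark that says that
the simulated computation has been successful. -/
abbrev SimState (H : ℕ) : Type :=
  Option A × Triple A × (Fin (3 * (H + 4)) → M.Cell) × Bool

/-- A window as a row. -/
def window {H : ℕ} (W : Fin (3 * (H + 4)) → M.Cell) (k : ℤ) : M.Cell :=
  if h : 0 ≤ k ∧ k < 3 * (H + 4) then W ⟨k.toNat, by omega⟩ else none

theorem window_apply {H : ℕ} (f : ℤ → M.Cell) {k : ℤ} (h0 : 0 ≤ k) (h : k < 3 * (H + 4)) :
    M.window (H := H) (fun k => f k) k = f k := by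
  rw [window, dif_pos ⟨h0, h⟩]
  simp [Int.toNat_of_nonneg h0]

open Classical in
/-- The window of the left neighbour; for the leftmost cell, a window of the initial row. -/
noncomputable def leftWindow (H : ℕ) (l : Option (M.SimState H)) (c : M.SimState H) :
    ℤ → M.Cell :=
  match l with
  | some l => M.window l.2.2.1
  | none =>
    -- The void test holds only at time 0, when the virtual left neighbour has the origin at the
    -- start of its second block. Later its windows are constant.
    if M.window c.2.2.1 (2 * (H + 4)) = none then fun k => M.initRow (k - (H + 4))
    else fun _ => M.initRow 0

/-- The left neighbour provides the block that contains the communication cell, and the next one. -/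
def Fires (H : ℕ) (f : ℤ → M.Cell) : Prop :=
  f (H + 3) = none ∧ f (H + 4) ≠ none

open Classical in
/-- The symbols collected by a cell after a step; `l` and `x` are the current symbols of the
neighbours. -/
noncomputable def nextTriple (H : ℕ) (f : ℤ → M.Cell) (l : Option (Option A)) (x : Option A)
    (c : M.SimState H) : Triple A :=
  if M.Fires H f then (l, c.1, x) else c.2.1

/-- The window of a cell after a step: two blocks are kept, and a new one is computed from the
window `f` of the left neighbour. -/
noncomputable def nextWindow (H : ℕ) (f : ℤ → M.Cell) (m : Triple A) (c : M.SimState H) :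
    Fin (3 * (H + 4)) → M.Cell := fun k =>
  if k.val < 2 * (H + 4) then M.window c.2.2.1 (H + 4 + k)
  else M.advance (symbols H m) f (k - (H + 4))

open Classical in
/-- The output of a cell with the current symbol `a` and neighbours with the current symbols
`l` and `x`. -/
noncomputable def emitted (H : ℕ) (f : ℤ → M.Cell) (l : Option (Option A)) (a x : Option A) :
    Option (List B) :=
  -- In cell `i` at time `t` this means `i + t ≥ n` and `t + 2 ≤ 2i`, hence `3i ≥ n + 2`: the bundle
  -- starts after step `n + 1`.
  if a = none ∧ f (2 * (H + 4) + (H + 3)) = none then some []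
  else if M.Fires H f then some (M.emission (symbols H (l, a, x)) f (H + 4))
  -- Here `t = 2i - 1` and `3i ≥ n + 1`. Answering one step before firing matters for `n = 2`, `i =
  -- 1`, where time `2i` is too late.
  else if a = none ∧ f (H + 4 + (H + 3)) = none ∧ f (2 * (H + 4)) ≠ none then
    some (M.emission (symbols H (some none, none, none)) f (2 * (H + 4)))
  else none

open Classical in
/-- The cellular automaton transducer that simulates an iterative array transducer. -/
noncomputable def simCAT [Finite A] (M : IAT A B) (H : ℕ) : CAT A B where
  State := M.SimState H
  finite_state := by
    have := M.finite_state
    infer_instance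
  accepting := {c | c.2.2.2 = true}
  input := ⟨fun a => (some a, (none, none, none), fun _ => none, false), fun a b h => by
    simpa using congrArg Prod.fst h⟩
  delta l c r :=
    let f := M.leftWindow H l c
    let a := l.map Prod.fst
    let x := r.bind Prod.fst
    let m := M.nextTriple H f a x c
    ((x, m, M.nextWindow H f m c, c.2.2.2 || r.any (fun d => d.2.2.2) ||
        decide (M.window c.2.2.1 (2 * (H + 4)) = some (none, true))),
      M.emitted H f a c.1 x)

/-! #### The configurations of the simulating automaton -/

open Classical in
/-- The success mark of the cell `i` at time `t`. -/
noncomputable def simMark (H : ℕ) (w : List A) : ℕ → ℕ → Bool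
  | 0, _ => false
  | t + 1, i => simMark H w t i || (decide (i + 1 < w.length) && simMark H w t (i + 1)) ||
      decide (M.row w (start H w (i + 1)) ((H + 4) * (t - 2 * i - 3) + 2 * (H + 4)) =
        some (none, true))

/-- The state of the cell `i` at time `t`. -/
noncomputable def simState (H : ℕ) (w : List A) (t i : ℕ) : M.SimState H :=
  (w[i + t]?, if 2 * i + 1 ≤ t then tripleAt w i else (none, none, none),
    fun k => M.row w (start H w (i + 1)) ((H + 4) * (t - 2 * i - 3) + k), M.simMark H w t i)

/-- An offset inside a block does not affect the sign of a position, so tests for void cells become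
inequalities between times. -/
theorem block_neg_iff {g : ℤ} (c d : ℤ) {r : ℤ} (h0 : 0 ≤ r) (hr : r < g) :
    g * c + (g * d + r) < 0 ↔ c + d < 0 := by
  constructor
  · intro h
    by_contra hcd
    have := mul_nonneg (h0.trans hr.le) (not_lt.1 hcd)
    linarith [mul_add g c d]
  · intro h
    have : g * (c + d) ≤ g * (-1) := mul_le_mul_of_nonneg_left (by omega) (h0.trans hr.le)
    linarith [mul_add g c d]

theorem window_simState {H : ℕ} {w : List A} {t i : ℕ} {k : ℤ} (h0 : 0 ≤ k)
    (hk : k < 3 * (H + 4)) : M.window (M.simState H w t i).2.2.1 k =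
      M.row w (start H w (i + 1)) ((H + 4) * (t - 2 * i - 3) + k) :=
  M.window_apply (fun k => M.row w (start H w (i + 1)) ((H + 4) * (t - 2 * i - 3) + k)) h0 hk

/-- The left neighbour of the cell `i` at time `t`, as an optional state. -/
noncomputable def simLeft (H : ℕ) (w : List A) (t i : ℕ) : Option (M.SimState H) :=
  if 0 < i then some (M.simState H w t (i - 1)) else none

/-- The window that the cell `i` uses at time `t`. -/
noncomputable def simLeftWindow (H : ℕ) (w : List A) (t i : ℕ) : ℤ → M.Cell :=
  M.leftWindow H (M.simLeft H w t i) (M.simState H w t i)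

/-- The virtual neighbour of cell 0 obeys the same formula as a real one, with the initial row as
its row. -/
theorem simLeftWindow_apply {H : ℕ} {w : List A} {t i : ℕ} {k : ℤ} (h0 : 0 ≤ k)
    (hk : k < 3 * (H + 4)) : M.simLeftWindow H w t i k =
      M.row w (start H w i) ((H + 4) * (t - 2 * i - 1) + k) := by
  unfold simLeftWindow simLeft
  rcases Nat.eq_zero_or_pos i with rfl | hi
  · simp only [lt_irrefl, if_false, leftWindow]
    have hnone : M.window (M.simState H w t 0).2.2.1 (2 * (H + 4)) = none ↔ (t : ℤ) - 1 < 0 := by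
      have := block_neg_iff (g := H + 4) ((t : ℤ) - 2 * (0 : ℕ) - 3) 2 le_rfl (by omega)
      rw [add_zero, mul_comm _ 2] at this
      rw [M.window_simState (by omega) (by omega), row_eq_none_iff, this]
      omega
    simp only [hnone]
    rcases Nat.eq_zero_or_pos t with rfl | ht
    · rw [if_pos (by norm_num)]
      simp only [start, row]
      congr 1
      push_cast
      ring
    · rw [if_neg (by omega)]
      have h1 : 0 ≤ ((H : ℤ) + 4) * (t - 2 * (0 : ℕ) - 1) := mul_nonneg (by omega) (by omega)
      simp only [start, row, initRow]
      rw [if_neg (by omega), if_neg (by omega)]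
  · obtain ⟨i, rfl⟩ := Nat.exists_eq_succ_of_ne_zero hi.ne'
    simp only [hi, if_true, leftWindow]
    rw [M.window_simState h0 hk]
    simp only [Nat.succ_eq_add_one, Nat.add_sub_cancel]
    congr 2
    push_cast
    ring

theorem simLeftWindow_eq_none_iff {H : ℕ} {w : List A} {t i : ℕ} (d : ℤ) {r : ℤ} (h0 : 0 ≤ r)
    (hr : r < H + 4) (hd : 0 ≤ d) (hd' : d ≤ 2) :
    M.simLeftWindow H w t i ((H + 4) * d + r) = none ↔ (t : ℤ) - 2 * i - 1 + d < 0 := by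
  have h1 : 0 ≤ ((H : ℤ) + 4) * d := mul_nonneg (by omega) hd
  have h2 : ((H : ℤ) + 4) * d ≤ (H + 4) * 2 := mul_le_mul_of_nonneg_left hd' (by omega)
  rw [M.simLeftWindow_apply (by omega) (by omega), row_eq_none_iff, block_neg_iff _ _ h0 hr]

theorem fires_iff {H : ℕ} {w : List A} {t i : ℕ} :
    M.Fires H (M.simLeftWindow H w t i) ↔ t = 2 * i := by
  have h1 := M.simLeftWindow_eq_none_iff (H := H) (w := w) (t := t) (i := i) 0 (r := H + 3)
    (by omega) (by omega) (by omega) (by omega)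
  have h2 := M.simLeftWindow_eq_none_iff (H := H) (w := w) (t := t) (i := i) 1 (r := 0)
    (by omega) (by omega) (by omega) (by omega)
  rw [mul_zero, zero_add] at h1
  rw [mul_one, add_zero] at h2
  rw [Fires, h1, Ne, h2]
  omega

/-- A bundle has fewer than `H + 4` steps, so the light cone of the middle block stays inside the
three blocks. -/
theorem advance_simLeftWindow {H : ℕ} {w : List A} {t i : ℕ} (m : Triple A) {k : ℤ}
    (h0 : H + 4 ≤ k) (hk : k < 2 * (H + 4)) :
    M.advance (symbols H m) (M.simLeftWindow H w t i) k =
      M.advance (symbols H m) (M.row w (start H w i)) ((H + 4) * (t - 2 * i - 1) + k) := by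
  have hlen := length_symbols_lt H m
  rw [M.advance_congr (f' := fun k => M.row w (start H w i) ((H + 4) * (t - 2 * i - 1) + k))
    (fun k' h1 h2 => M.simLeftWindow_apply (by omega) (by omega)) k le_rfl le_rfl,
    M.advance_shift]

theorem emission_simLeftWindow {H : ℕ} {w : List A} {t i : ℕ} (m : Triple A) {k : ℤ}
    (h0 : H + 4 ≤ k) (hk : k ≤ 2 * (H + 4)) :
    M.emission (symbols H m) (M.simLeftWindow H w t i) k =
      M.emission (symbols H m) (M.row w (start H w i)) ((H + 4) * (t - 2 * i - 1) + k) := by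
  have hlen := length_symbols_lt H m
  rw [M.emission_congr (f' := fun k => M.row w (start H w i) ((H + 4) * (t - 2 * i - 1) + k))
    (fun k' h1 h2 => M.simLeftWindow_apply (by omega) (by omega)), M.emission_shift]

theorem simLeft_map (H : ℕ) (w : List A) (t i : ℕ) :
    (M.simLeft H w t i).map Prod.fst = if i = 0 then none else some w[i - 1 + t]? := by
  rcases Nat.eq_zero_or_pos i with rfl | hi
  · simp [simLeft]
  · simp [simLeft, hi, hi.ne', simState]

theorem triple_of_eq {w : List A} {t i : ℕ} (ht : t = 2 * i) :
    ((if i = 0 then none else some w[i - 1 + t]?, w[i + t]?, w[i + 1 + t]?) : Triple A) =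
      tripleAt w i := by
  subst ht
  unfold tripleAt
  rw [show i + 2 * i = 3 * i by omega, show i + 1 + 2 * i = 3 * i + 1 by omega]
  split_ifs
  · rfl
  · rw [show i - 1 + 2 * i = 3 * i - 1 by omega]

theorem nextTriple_sim {H : ℕ} {w : List A} {t i : ℕ} :
    M.nextTriple H (M.simLeftWindow H w t i) ((M.simLeft H w t i).map Prod.fst) w[i + 1 + t]?
      (M.simState H w t i) = (M.simState H w (t + 1) i).2.1 := by
  simp only [nextTriple, fires_iff, simLeft_map, simState]
  by_cases h : t = 2 * i
  · rw [if_pos h, if_pos (show 2 * i + 1 ≤ t + 1 by omega)]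
    exact triple_of_eq h
  · rw [if_neg h]
    congr 1
    rw [eq_iff_iff]
    omega

theorem nextWindow_sim {H : ℕ} (hH : 0 < H) {w : List A} {t i : ℕ} :
    M.nextWindow H (M.simLeftWindow H w t i) (M.simState H w (t + 1) i).2.1
      (M.simState H w t i) = (M.simState H w (t + 1) i).2.2.1 := by
  funext k
  have hk := k.isLt
  have hr : (M.simState H w (t + 1) i).2.2.1 k =
    M.row w (start H w (i + 1)) ((H + 4) * ((t + 1 : ℕ) - 2 * i - 3) + k) := rfl
  rw [hr]
  unfold nextWindow
  split_ifs with h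
  · rw [M.window_simState (by omega) (by omega)]
    congr 1
    push_cast
    ring
  · have e : ((H : ℤ) + 4) * (t - 2 * i - 1) + (k - (H + 4)) =
        (H + 4) * ((t + 1 : ℕ) - 2 * i - 3) + k := by push_cast; ring
    rw [M.advance_simLeftWindow _ (by omega) (by omega), e]
    by_cases ht : 2 * i + 1 ≤ t + 1
    · simp only [simState, if_pos ht]
      rw [advance_symbols M hH]
    -- Before firing the stored triple is meaningless, but the new block is void and void cells stay
    -- void under any symbols.
    · have hneg : ((H : ℤ) + 4) * ((t + 1 : ℕ) - 2 * i - 3) + k < 0 := by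
        have : ((H : ℤ) + 4) * ((t + 1 : ℕ) - 2 * i - 3) ≤ (H + 4) * (-3) :=
          mul_le_mul_of_nonneg_left (by omega) (by omega)
        omega
      rw [M.row_eq_none_iff.2 hneg, advance_eq_none_iff, M.row_eq_none_iff.2 hneg]

theorem simCAT_delta [Finite A] {H : ℕ} (hH : 0 < H) {w : List A} {t i : ℕ} :
    (M.simCAT H).delta (M.simLeft H w t i) (M.simState H w t i)
        (if i + 1 < w.length then some (M.simState H w t (i + 1)) else none) =
      (M.simState H w (t + 1) i,
        M.emitted H (M.simLeftWindow H w t i) (if i = 0 then none else some w[i - 1 + t]?)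
          w[i + t]? w[i + 1 + t]?) := by
  have hx : (if i + 1 < w.length then some (M.simState H w t (i + 1)) else none).bind Prod.fst =
      w[i + 1 + t]? := by
    split_ifs with h
    · rfl
    · rw [List.getElem?_eq_none (by omega)]; rfl
  have h1 := M.nextTriple_sim (H := H) (w := w) (t := t) (i := i)
  have h2 := M.nextWindow_sim hH (w := w) (t := t) (i := i)
  have hl := M.simLeft_map H w t i
  simp only [simCAT]
  rw [show M.leftWindow H (M.simLeft H w t i) (M.simState H w t i) = M.simLeftWindow H w t i
    from rfl, hx, h1, h2, hl]
  refine Prod.ext (Prod.ext ?_ (Prod.ext rfl (Prod.ext rfl ?_))) rfl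
  · simp only [simState]
    congr 1
    omega
  · simp only
    rw [M.window_simState (by omega) (by omega)]
    simp only [simState, simMark]
    congr 2
    split_ifs with h <;> simp [h]

theorem simCAT_run_state [Finite A] {H : ℕ} (hH : 0 < H) (w : List A) (t : ℕ)
    (i : Fin w.length) : ((M.simCAT H).run w t).state i = M.simState H w t i := by
  induction t generalizing i with
  | zero =>
    have h : ∀ k : Fin (3 * (H + 4)),
        M.row w (start H w (i + 1)) ((H + 4) * ((0 : ℕ) - 2 * i - 3) + k) = none := fun k => by
      have hk := k.isLt
      have : ((H : ℤ) + 4) * ((0 : ℕ) - 2 * i - 3) ≤ (H + 4) * (-3) :=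
        mul_le_mul_of_nonneg_left (by omega) (by omega)
      rw [row_eq_none_iff]
      omega
    simp only [simState, h, simMark]
    simp [CAT.run, CAT.init]
    rfl
  | succ t ih =>
    simp only [CAT.run, CAT.step, CAT.localStep]
    rw [CAT.leftOf_eq (M.simCAT H) (g := M.simState H w t) ih i,
      CAT.rightOf_eq (M.simCAT H) (g := M.simState H w t) ih i, ih]
    exact congrArg Prod.fst (M.simCAT_delta hH)

theorem simCAT_run_out [Finite A] {H : ℕ} (hH : 0 < H) (w : List A) (t : ℕ)
    (i : Fin w.length) : ((M.simCAT H).run w (t + 1)).out i =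
      match ((M.simCAT H).run w t).out i with
      | some u => some u
      | none => M.emitted H (M.simLeftWindow H w t i)
          (if i.val = 0 then none else some w[i - 1 + t]?) w[i + t]? w[i + 1 + t]? := by
  have h := congrArg Prod.snd (M.simCAT_delta (i := i) (t := t) (w := w) hH)
  simp only [CAT.run, CAT.step, CAT.localStep]
  rw [CAT.leftOf_eq (M.simCAT H) (g := M.simState H w t) (M.simCAT_run_state hH w t) i,
    CAT.rightOf_eq (M.simCAT H) (g := M.simState H w t) (M.simCAT_run_state hH w t) i,
    M.simCAT_run_state hH]
  exact congrArg (fun o => match ((M.simCAT H).run w t).out i with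
      | some u => some u
      | none => o) h

/-! #### The output of the simulating automaton -/

theorem emitted_eq_none_or {H : ℕ} (hH : 0 < H) {w : List A} {v : List B}
    (hv : ∀ s, w.length + 1 ≤ s → M.total w s = v) (t i : ℕ) :
    M.emitted H (M.simLeftWindow H w t i) (if i = 0 then none else some w[i - 1 + t]?)
        w[i + t]? w[i + 1 + t]? = none ∨
      M.emitted H (M.simLeftWindow H w t i) (if i = 0 then none else some w[i - 1 + t]?)
        w[i + t]? w[i + 1 + t]? = some (M.wordAt H w i) := by
  have e0 := M.simLeftWindow_eq_none_iff (H := H) (w := w) (t := t) (i := i) 2 (r := H + 3)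
    (by omega) (by omega) (by omega) (by omega)
  have e1 := M.simLeftWindow_eq_none_iff (H := H) (w := w) (t := t) (i := i) 1 (r := H + 3)
    (by omega) (by omega) (by omega) (by omega)
  have e2 := M.simLeftWindow_eq_none_iff (H := H) (w := w) (t := t) (i := i) 2 (r := 0)
    (by omega) (by omega) (by omega) (by omega)
  rw [mul_comm _ 2] at e0
  rw [mul_one] at e1
  rw [add_zero, mul_comm _ 2] at e2
  generalize hl : (if i = 0 then none else some w[i - 1 + t]?) = l
  simp only [emitted, e0, e1, Ne, e2, fires_iff, List.getElem?_eq_none_iff]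
  split_ifs with h1 h2 h3
  · right
    have hs := le_start hH w i
    have h := M.total_start_succ hH w i
    -- The total is already `v` before and after the bundle, so its word is empty.
    have hmono : start H w i ≤ start H w (i + 1) := start_mono w (Nat.le_succ i)
    rw [hv (start H w i) (by omega), hv (start H w (i + 1)) (by omega)] at h
    rw [List.self_eq_append_right.1 h]
  · right
    rw [M.emission_simLeftWindow _ le_rfl (by omega), ← hl, triple_of_eq h2, wordAt, h2]
    congr 2
    push_cast
    ring
  · right
    have ht : t + 1 = 2 * i := by omega
    have hm : tripleAt w i = (some none, none, none) := by
      simp [tripleAt, show i ≠ 0 by omega, List.getElem?_eq_none (show w.length ≤ 3 * i - 1 by omega),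
        List.getElem?_eq_none (show w.length ≤ 3 * i by omega),
        List.getElem?_eq_none (show w.length ≤ 3 * i + 1 by omega)]
    rw [M.emission_simLeftWindow _ (by omega) le_rfl, wordAt, hm,
      show (t : ℤ) = 2 * i - 1 by omega]
    congr 2
    ring
  · left; rfl

/-- The three cases `3i > n + 1`, `3i = n + 1` and `3i ≤ n` are served at the times `n - i`, `2i -
1` and `2i`, all below `n`. -/
theorem exists_emitted {H : ℕ} {w : List A} {i : ℕ} (hi : i < w.length) :
    ∃ t < w.length, M.emitted H (M.simLeftWindow H w t i)
      (if i = 0 then none else some w[i - 1 + t]?) w[i + t]? w[i + 1 + t]? ≠ none := by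
  rcases Nat.lt_or_ge (w.length + 1) (3 * i) with h | h
  · refine ⟨w.length - i, by omega, ?_⟩
    have e0 := M.simLeftWindow_eq_none_iff (H := H) (w := w) (t := w.length - i) (i := i) 2
      (r := H + 3) (by omega) (by omega) (by omega) (by omega)
    rw [mul_comm _ 2] at e0
    rw [emitted, if_pos ⟨List.getElem?_eq_none (by omega), e0.2 (by omega)⟩]
    simp
  rcases Nat.lt_or_ge w.length (3 * i) with h' | h'
  · refine ⟨2 * i - 1, by omega, ?_⟩
    have e1 := M.simLeftWindow_eq_none_iff (H := H) (w := w) (t := 2 * i - 1) (i := i) 1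
      (r := H + 3) (by omega) (by omega) (by omega) (by omega)
    have e2 := M.simLeftWindow_eq_none_iff (H := H) (w := w) (t := 2 * i - 1) (i := i) 2 (r := 0)
      (by omega) (by omega) (by omega) (by omega)
    rw [mul_one] at e1
    rw [add_zero, mul_comm _ 2] at e2
    have h3 : w[i + (2 * i - 1)]? = none ∧
        M.simLeftWindow H w (2 * i - 1) i (H + 4 + (H + 3)) = none ∧
        M.simLeftWindow H w (2 * i - 1) i (2 * (H + 4)) ≠ none :=
      ⟨List.getElem?_eq_none (by omega), e1.2 (by omega), mt e2.1 (by omega)⟩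
    unfold emitted
    split_ifs
    all_goals simp
  · refine ⟨2 * i, by omega, ?_⟩
    have h3 := (M.fires_iff (H := H) (w := w) (t := 2 * i) (i := i)).2 rfl
    unfold emitted
    split_ifs
    all_goals simp

theorem simCAT_out_eq_none_or [Finite A] {H : ℕ} (hH : 0 < H) {w : List A} {v : List B}
    (hv : ∀ s, w.length + 1 ≤ s → M.total w s = v) (t : ℕ) (i : Fin w.length) :
    ((M.simCAT H).run w t).out i = none ∨
      ((M.simCAT H).run w t).out i = some (M.wordAt H w i) := by
  induction t with
  | zero => exact Or.inl rfl
  | succ t ih =>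
    rw [M.simCAT_run_out hH]
    rcases ih with h | h
    · rw [h]
      exact M.emitted_eq_none_or hH hv t i
    · rw [h]
      exact Or.inr rfl

theorem simCAT_out [Finite A] {H : ℕ} (hH : 0 < H) {w : List A} {v : List B}
    (hv : ∀ s, w.length + 1 ≤ s → M.total w s = v) (i : Fin w.length) :
    ((M.simCAT H).run w w.length).out i = some (M.wordAt H w i) := by
  obtain ⟨t, ht, he⟩ := M.exists_emitted (H := H) i.isLt
  have hne : ((M.simCAT H).run w (t + 1)).out i ≠ none := by
    rw [M.simCAT_run_out hH]
    split
    · simp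
    · exact he
  exact (M.simCAT H).out_persists w ht
    ((M.simCAT_out_eq_none_or hH hv (t + 1) i).resolve_left hne)

theorem simCAT_outputsAt [Finite A] {H : ℕ} (hH : 0 < H) {w : List A} (hw : w ≠ []) {v : List B}
    (hv : ∀ s, w.length + 1 ≤ s → M.total w s = v) :
    (M.simCAT H).OutputsAt w v w.length := by
  refine ⟨fun i => M.wordAt H w i, fun i => M.simCAT_out hH hv i, ?_⟩
  have hn := List.length_pos_iff.2 hw
  have hs := le_start hH w w.length
  rw [List.ofFn_eq_map_range, M.flatten_wordAt hH, hv _ (by omega)]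

/-! #### The success mark -/

theorem exists_row_of_simMark {H : ℕ} (hH : 0 < H) {w : List A} {t i : ℕ}
    (h : M.simMark H w t i = true) : ∃ s, M.row w s 0 = some (none, true) := by
  induction t generalizing i with
  | zero => simp [simMark] at h
  | succ t ih =>
    simp only [simMark, Bool.or_eq_true, Bool.and_eq_true, decide_eq_true_eq] at h
    rcases h with (h | h) | h
    · exact ih h
    · exact ih h.2
    · have hs := le_start hH w (i + 1)
      have h0 := M.eq_zero_of_row_eq (by omega) h
      rw [h0] at h
      exact ⟨_, h⟩

/-- Cell `i + d` detects success at time `2(i + d) + 2`; the mark then needs `d` steps to the left.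
-/
theorem simMark_of_row {H : ℕ} {w : List A} {i : ℕ} (d : ℕ) (hi : i + d < w.length)
    (h : M.row w (start H w (i + d + 1)) 0 = some (none, true)) :
    M.simMark H w (2 * (i + d) + 2 + d) i = true := by
  induction d generalizing i with
  | zero =>
    rw [show 2 * (i + 0) + 2 + 0 = 2 * i + 1 + 1 by omega, simMark]
    have e : ((H : ℤ) + 4) * ((2 * i + 1 : ℕ) - 2 * i - 3) + 2 * (H + 4) = 0 := by
      push_cast; ring
    rw [e]
    simp only [add_zero] at h
    simp [h]
  | succ d ih =>
    have h1 := ih (i := i + 1) (by omega) (by rwa [show i + 1 + d = i + (d + 1) by omega])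
    rw [show 2 * (i + 1 + d) + 2 + d = 2 * (i + (d + 1)) + 2 + d by omega] at h1
    rw [← Nat.add_assoc, simMark, h1]
    simp [show i + 1 < w.length by omega]

theorem simCAT_acceptsAt_iff [Finite A] {H : ℕ} (hH : 0 < H) {w : List A} (hw : w ≠ []) {t : ℕ} :
    (M.simCAT H).AcceptsAt w t ↔ M.simMark H w t 0 = true := by
  have hn := List.length_pos_iff.2 hw
  constructor
  · rintro ⟨h, h'⟩
    rw [M.simCAT_run_state hH] at h'
    exact h'
  · intro h
    refine ⟨hn, ?_⟩
    rw [M.simCAT_run_state hH]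
    exact h

theorem simCAT_acceptsAt [Finite A] {H : ℕ} (hH : 0 < H) {w : List A} (hw : w ≠ []) {T : ℕ}
    (hT : M.HaltsAt w T) (hle : T + 1 ≤ start H w w.length) (ha : ∃ t, M.AcceptsAt w t) :
    (M.simCAT H).AcceptsAt w (3 * w.length - 1) := by
  have hn := List.length_pos_iff.2 hw
  rw [M.simCAT_acceptsAt_iff hH hw]
  have h := M.simMark_of_row (H := H) (w := w) (i := 0) (w.length - 1) (by omega) (by
    rw [row_zero_eq_iff, show 0 + (w.length - 1) + 1 = w.length by omega]
    exact ⟨run_eq_none_mono hle hT.2, ha⟩)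
  rwa [show 2 * (0 + (w.length - 1)) + 2 + (w.length - 1) = 3 * w.length - 1 by omega] at h

/-! #### The simulation -/

theorem exists_cat [Finite A] {tI : ℕ → ℕ} {N : ℕ} (hN : ∀ n, tI n ≤ N * n)
    (hT : M.HasTime tI fun n => n + 1) :
    ∃ M' : CAT A B, M'.HasTime (fun n => 3 * n) (fun n => n) ∧
      M'.transduction = M.transduction := by
  -- At least half of the `n` bundles contain `H` steps, giving `(N + 3)n` in all, enough for `max
  -- (N * n) (n + 1) + 1`.
  set H := 2 * (N + 3) with hHdef
  have hH : 0 < H := by omega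
  have hfwd : ∀ w v, (w, v) ∈ M.transduction →
      (M.simCAT H).AcceptsAt w (3 * w.length - 1) ∧ (M.simCAT H).OutputsAt w v w.length := by
    intro w v h
    obtain ⟨-, -, T, hle, hhalt⟩ := hT _ h
    have hw : w ≠ [] := h.1
    have hn := List.length_pos_iff.2 hw
    refine ⟨M.simCAT_acceptsAt hH hw hhalt ?_ h.2.1,
      M.simCAT_outputsAt hH hw fun s hs => M.total_eq_of_hasTime hT h hs⟩
    dsimp only at hle
    have h1 := mul_le_start H w w.length
    have h2 : H * w.length = H * (w.length - (w.length + 1) / 3) + H * ((w.length + 1) / 3) := by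
      rw [← Nat.mul_add]; congr 1; omega
    have h3 : (N + 3) * w.length ≤ H * (w.length - (w.length + 1) / 3) := by
      rw [hHdef, Nat.mul_comm 2, Nat.mul_assoc]
      exact Nat.mul_le_mul_left _ (by omega)
    have h4 := hN w.length
    have h5 : (N + 3) * w.length = N * w.length + 3 * w.length := Nat.add_mul _ _ _
    omega
  have hback : ∀ w v, (w, v) ∈ (M.simCAT H).transduction → (w, v) ∈ M.transduction := by
    rintro w v ⟨hw, ⟨t, ht⟩, t', ht'⟩
    dsimp only at hw ht ht'
    obtain ⟨s, hs⟩ := M.exists_row_of_simMark hH ((M.simCAT_acceptsAt_iff hH hw).1 ht)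
    obtain ⟨hnone, hacc⟩ := M.row_zero_eq_iff.1 hs
    obtain ⟨T, hhalt⟩ := M.exists_haltsAt hnone
    obtain ⟨C, hC⟩ := hhalt.1
    have hmem : (w, C.out) ∈ M.transduction := ⟨hw, hacc, T, hhalt, C, hC, rfl⟩
    -- The registers are only known to be correct on inputs in the domain of `M`; the success mark
    -- guarantees this, and filled registers never change.
    rwa [ht'.unique (hfwd w C.out hmem).2]
  refine ⟨M.simCAT H, ?_, ?_⟩
  · rintro ⟨w, v⟩ h
    obtain ⟨h1, u, hu, -⟩ := hfwd w v (hback w v h)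
    exact ⟨⟨_, Nat.sub_le _ _, h1⟩, _, le_rfl, fun i => by rw [hu i]; simp⟩
  · ext ⟨w, v⟩
    refine ⟨hback w v, fun h => ?_⟩
    obtain ⟨h1, h2⟩ := hfwd w v h
    exact ⟨h.1, ⟨_, h1⟩, _, h2⟩

end IAT

/-! ### Inclusion of the families and conclusion -/

theorem mul_mem_linearTime {k : ℕ} (hk : 1 ≤ k) : (fun n => k * n) ∈ linearTime := by
  refine ⟨k, by exact_mod_cast hk, fun n => ?_⟩
  rw [← Nat.cast_mul, Nat.floor_natCast]

theorem iatFamily_subset_catFamily :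
    iatFamily linearTime iatRealTime ⊆ catFamily linearTime catRealTime := by
  rintro T ⟨M, tI, ⟨k, hk, htI⟩, _, rfl, hT, hM⟩
  have := T.finite_in
  obtain ⟨M', hT', hM'⟩ := M.exists_cat (N := ⌈k⌉₊) (fun n => by
    rw [htI]
    refine Nat.floor_le_of_le ?_
    push_cast
    exact mul_le_mul_of_nonneg_right (Nat.le_ceil k) (Nat.cast_nonneg n)) hT
  exact ⟨M', _, mul_mem_linearTime (by norm_num), _, rfl, hT', hM'.trans hM⟩

theorem mainTheorem7 :
    iatFamily linearTime iatRealTime ⊂ catFamily linearTime catRealTime ∧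
    reversalTransduction ∈ catFamily catRealTime catRealTime ∧
    reversalTransduction ∉ iatFamily iatRealTime iatRealTime ∧
    reversalTransduction ∉ iatFamily linearTime iatRealTime :=
  ⟨⟨iatFamily_subset_catFamily, fun h => reversal_notMem_iatFamily _
      (h (reversal_mem_catFamily ⟨_, mul_mem_linearTime le_rfl⟩))⟩,
    reversal_mem_catFamily ⟨_, rfl⟩, reversal_notMem_iatFamily _, reversal_notMem_iatFamily _⟩
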